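/- Let $\mathcal M$ be a smooth time-oriented Lorentzian manifold of dimension $n+2$ with metric $g$ of signature $(-,+,\dots,+)$ and Levi-Civita connection $\nabla$. Let $H\subset\mathcal M$ be an embedded $C^2$ hypersurface with a $C^2$ scalar field $\tau:H\to\mathbb R$ without critical points whose level sets $\sigma(\tau)$, the leaves, are compact and acausal surfaces of dimension $n$. Let $k,\ell$ be the two future-directed null vector fields of class $C^1$ along $H$ that are orthogonal to the leaves, normalized by $k\cdot\ell=-1$. For $u\in\{k,\ell\}$ let $\theta_u=q^{ij}\,g(\nabla_{e_i}u,e_j)$ be the expansion of the leaf in the direction $u$, where $(e_i)$ is a basis of the tangent space of the leaf, $q_{ij}=g(e_i,e_j)$ is its induced metric and $(q^{ij})$ is the inverse matrix. Call $H$ a future holographic screen if $\theta_k=0$ and $\theta_\ell<0$ everywhere on $H$, and a past holographic screen if $\theta_k=0$ and $\theta_\ell>0$ everywhere on $H$. Let $h=\partial_\tau$ be the vector field tangent to $H$ and orthogonal to the leaves with $d\tau(h)=1$, and write $h=\alpha\ell+\beta k$ with scalar fields $\alpha,\beta$ on $H$. Let $(x^1,\dots,x^n,\tau)$ be local coordinates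 of class $C^1$ on $H$ in which $h$ is the coordinate vector field $\partial_\tau$ (so that the $x^i$ are coordinates on each leaf that are constant along the flow of $h$), and let $\delta A=\sqrt{\det(q_{ij})}\,dx^1\cdots dx^n$ be the proper area element of the leaf, where $q_{ij}$ are now the components of its induced metric in the coordinates $x^i$. If $H$ is a future or a past holographic screen, then at every point $p$ of a leaf $\sigma(\tau)$ in the domain of the coordinates, $\delta A$ is positive and differentiable along the flow, and $$\frac{1}{\delta A(p)}\,\frac{d}{d\tau}\,\delta A(p)=\alpha(p)\,\theta_\ell(p).$$ For a future holographic screen (where $\theta_\ell<0$) this rate is strictly positive if and only if $\alpha(p)<0$; for a past holographic screen (where $\theta_\ell>0$) it is strictly positive if and only if $\alpha(p)>0$. -/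

import Mathlib

open scoped Manifold ContDiff

noncomputable section

/-- A time-oriented Lorentzian metric (signature `(-,+,…,+)`) on a manifold of dimension `n + 2`. -/
structure Spacetime (n : ℕ) (M : Type*) [TopologicalSpace M]
    [ChartedSpace (EuclideanSpace ℝ (Fin (n + 2))) M] [IsManifold (𝓡 (n + 2)) ∞ M] where
  /-- the metric tensor -/
  g : ∀ x : M, TangentSpace (𝓡 (n + 2)) x →L[ℝ] TangentSpace (𝓡 (n + 2)) x →L[ℝ] ℝ
  g_symm : ∀ (x : M) (v w : TangentSpace (𝓡 (n + 2)) x), g x v w = g x w v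
  g_smooth : ContMDiff (𝓡 (n + 2))
    ((𝓡 (n + 2)).prod 𝓘(ℝ, EuclideanSpace ℝ (Fin (n + 2)) →L[ℝ]
      EuclideanSpace ℝ (Fin (n + 2)) →L[ℝ] ℝ)) ∞
    (fun x : M ↦ Bundle.TotalSpace.mk' (EuclideanSpace ℝ (Fin (n + 2)) →L[ℝ]
      EuclideanSpace ℝ (Fin (n + 2)) →L[ℝ] ℝ)
      (E := fun x : M ↦ TangentSpace (𝓡 (n + 2)) x →L[ℝ] TangentSpace (𝓡 (n + 2)) x →L[ℝ] ℝ)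
      x (g x))
  /-- the time orientation: a continuous timelike vector field, future-directed by definition -/
  T : ∀ x : M, TangentSpace (𝓡 (n + 2)) x
  T_continuous : Continuous (fun x : M ↦ (⟨x, T x⟩ : TangentBundle (𝓡 (n + 2)) M))
  T_timelike : ∀ x : M, g x (T x) (T x) < 0
  /-- the metric is positive definite on the orthogonal complement of a timelike vector -/
  pos_of_orthogonal : ∀ (x : M) (v : TangentSpace (𝓡 (n + 2)) x),
    v ≠ 0 → g x (T x) v = 0 → 0 < g x v v

namespace Spacetime

variable {n : ℕ} {M : Type*} [TopologicalSpace M]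
  [ChartedSpace (EuclideanSpace ℝ (Fin (n + 2))) M] [IsManifold (𝓡 (n + 2)) ∞ M]

/-- Future-directed vectors, among the causal ones. -/
def FutureDirected (G : Spacetime n M) {x : M} (v : TangentSpace (𝓡 (n + 2)) x) : Prop :=
  G.g x (G.T x) v < 0

/-- Timelike or null nonzero vectors. -/
def IsCausal (G : Spacetime n M) {x : M} (v : TangentSpace (𝓡 (n + 2)) x) : Prop :=
  v ≠ 0 ∧ G.g x v v ≤ 0

/-- `x` is joined to `y` by a future-directed causal curve of class `C¹`. -/
def CausalArc (G : Spacetime n M) (x y : M) : Prop :=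
  ∃ γ : ℝ → M, ContMDiffOn 𝓘(ℝ, ℝ) (𝓡 (n + 2)) 1 γ (Set.Icc 0 1) ∧ γ 0 = x ∧ γ 1 = y ∧
    ∀ t ∈ Set.Icc (0 : ℝ) 1,
      G.IsCausal (mfderivWithin 𝓘(ℝ, ℝ) (𝓡 (n + 2)) γ (Set.Icc 0 1) t (1 : ℝ)) ∧
      G.FutureDirected (mfderivWithin 𝓘(ℝ, ℝ) (𝓡 (n + 2)) γ (Set.Icc 0 1) t (1 : ℝ))

/-- `x` is joined to `y` by a future-directed causal curve, piecewise of class `C¹`. -/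
def CausallyPrecedes (G : Spacetime n M) : M → M → Prop :=
  Relation.TransGen G.CausalArc

/-- No two distinct points of the set are joined by a causal curve. -/
def Acausal (G : Spacetime n M) (A : Set M) : Prop :=
  ∀ x ∈ A, ∀ y ∈ A, x ≠ y → ¬ G.CausallyPrecedes x y

/-- The components of the metric in the preferred chart `φ` around `x₀`:
at the coordinate point `y`, `coordMetric x₀ y a b = g (dφ⁻¹ a) (dφ⁻¹ b)`. -/
def coordMetric (G : Spacetime n M) (x₀ : M) (y a b : EuclideanSpace ℝ (Fin (n + 2))) : ℝ :=
  G.g ((extChartAt (𝓡 (n + 2)) x₀).symm y)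
    (mfderiv 𝓘(ℝ, EuclideanSpace ℝ (Fin (n + 2))) (𝓡 (n + 2))
      (extChartAt (𝓡 (n + 2)) x₀).symm y a)
    (mfderiv 𝓘(ℝ, EuclideanSpace ℝ (Fin (n + 2))) (𝓡 (n + 2))
      (extChartAt (𝓡 (n + 2)) x₀).symm y b)

/-- The Christoffel symbols of the first kind of the metric in the chart around `x₀`,
`½ (∂_a g_{bc} + ∂_b g_{ac} - ∂_c g_{ab})`, at the coordinate point `y`. -/
def christoffel (G : Spacetime n M) (x₀ : M) (y a b c : EuclideanSpace ℝ (Fin (n + 2))) : ℝ :=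
  (1 / 2) * (fderiv ℝ (fun y' ↦ G.coordMetric x₀ y' b c) y a
    + fderiv ℝ (fun y' ↦ G.coordMetric x₀ y' a c) y b
    - fderiv ℝ (fun y' ↦ G.coordMetric x₀ y' a b) y c)

/-- The components of a tangent vector in the chart around `x₀`. -/
def coordVec (x₀ : M) {x : M} (v : TangentSpace (𝓡 (n + 2)) x) :
    EuclideanSpace ℝ (Fin (n + 2)) :=
  mfderiv (𝓡 (n + 2)) 𝓘(ℝ, EuclideanSpace ℝ (Fin (n + 2))) (extChartAt (𝓡 (n + 2)) x₀) x v

end Spacetime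

/-- A codimension-one `C²` hypersurface `H` of a spacetime, embedded by `ι`, with a scalar field
`τ` without critical points whose level sets are compact and acausal, and with the two future
directed null vector fields `k`, `l` orthogonal to the level sets, normalized by `k · l = -1`. -/
structure FoliatedHypersurface {n : ℕ} {M : Type*} [TopologicalSpace M]
    [ChartedSpace (EuclideanSpace ℝ (Fin (n + 2))) M] [IsManifold (𝓡 (n + 2)) ∞ M]
    (G : Spacetime n M) (H : Type*) [TopologicalSpace H]
    [ChartedSpace (EuclideanSpace ℝ (Fin (n + 1))) H] [IsManifold (𝓡 (n + 1)) 2 H] where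
  ι : H → M
  ι_contMDiff : ContMDiff (𝓡 (n + 1)) (𝓡 (n + 2)) 2 ι
  ι_isEmbedding : Topology.IsEmbedding ι
  ι_immersion : ∀ p : H, Function.Injective (mfderiv (𝓡 (n + 1)) (𝓡 (n + 2)) ι p)
  τ : H → ℝ
  τ_contMDiff : ContMDiff (𝓡 (n + 1)) 𝓘(ℝ, ℝ) 2 τ
  τ_regular : ∀ p : H, mfderiv (𝓡 (n + 1)) 𝓘(ℝ, ℝ) τ p ≠ 0
  leaf_compact : ∀ c : ℝ, IsCompact (τ ⁻¹' {c})
  leaf_acausal : ∀ c : ℝ, G.Acausal (ι '' (τ ⁻¹' {c}))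
  k : ∀ p : H, TangentSpace (𝓡 (n + 2)) (ι p)
  l : ∀ p : H, TangentSpace (𝓡 (n + 2)) (ι p)
  k_contMDiff : ContMDiff (𝓡 (n + 1)) (𝓡 (n + 2)).tangent 1
    (fun p ↦ (⟨ι p, k p⟩ : TangentBundle (𝓡 (n + 2)) M))
  l_contMDiff : ContMDiff (𝓡 (n + 1)) (𝓡 (n + 2)).tangent 1
    (fun p ↦ (⟨ι p, l p⟩ : TangentBundle (𝓡 (n + 2)) M))
  k_null : ∀ p : H, G.g (ι p) (k p) (k p) = 0
  l_null : ∀ p : H, G.g (ι p) (l p) (l p) = 0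
  k_future : ∀ p : H, G.FutureDirected (k p)
  l_future : ∀ p : H, G.FutureDirected (l p)
  k_l : ∀ p : H, G.g (ι p) (k p) (l p) = -1
  k_orthogonal : ∀ (p : H) (u : TangentSpace (𝓡 (n + 1)) p),
    mfderiv (𝓡 (n + 1)) 𝓘(ℝ, ℝ) τ p u = 0 →
      G.g (ι p) (k p) (mfderiv (𝓡 (n + 1)) (𝓡 (n + 2)) ι p u) = 0
  l_orthogonal : ∀ (p : H) (u : TangentSpace (𝓡 (n + 1)) p),
    mfderiv (𝓡 (n + 1)) 𝓘(ℝ, ℝ) τ p u = 0 →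
      G.g (ι p) (l p) (mfderiv (𝓡 (n + 1)) (𝓡 (n + 2)) ι p u) = 0

namespace FoliatedHypersurface

variable {n : ℕ} {M : Type*} [TopologicalSpace M]
  [ChartedSpace (EuclideanSpace ℝ (Fin (n + 2))) M] [IsManifold (𝓡 (n + 2)) ∞ M]
  {G : Spacetime n M} {H : Type*} [TopologicalSpace H]
  [ChartedSpace (EuclideanSpace ℝ (Fin (n + 1))) H] [IsManifold (𝓡 (n + 1)) 2 H]

/-- The tangent space at `p` of the leaf through `p`, as a subspace of the tangent space of `H`. -/
def leafTangent (S : FoliatedHypersurface G H) (p : H) :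
    Submodule ℝ (EuclideanSpace ℝ (Fin (n + 1))) :=
  LinearMap.ker (mfderiv (𝓡 (n + 1)) 𝓘(ℝ, ℝ) S.τ p).toLinearMap

/-- The metric induced on `H`, that is `g (dι u) (dι w)`; on `leafTangent` it is the induced
metric of the leaf. -/
def inducedMetric (S : FoliatedHypersurface G H) (p : H) (u w : TangentSpace (𝓡 (n + 1)) p) : ℝ :=
  G.g (S.ι p) (mfderiv (𝓡 (n + 1)) (𝓡 (n + 2)) S.ι p u)
    (mfderiv (𝓡 (n + 1)) (𝓡 (n + 2)) S.ι p w)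

/-- `g (∇_{dι u} V, dι w)` at `p`, for the Levi-Civita connection `∇` of the spacetime and a
spacetime vector field `V` along `H`, computed in the chart around `ι p`. Restricted to
tangent vectors `u`, `w` of the leaf this is the null extrinsic curvature for `V = k, l`. -/
def nullExtrinsicCurvature (S : FoliatedHypersurface G H)
    (V : ∀ p : H, TangentSpace (𝓡 (n + 2)) (S.ι p)) (p : H)
    (u w : TangentSpace (𝓡 (n + 1)) p) : ℝ :=
  G.coordMetric (S.ι p) (extChartAt (𝓡 (n + 2)) (S.ι p) (S.ι p))
    (mfderiv (𝓡 (n + 1)) 𝓘(ℝ, EuclideanSpace ℝ (Fin (n + 2)))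
      (fun q ↦ Spacetime.coordVec (S.ι p) (V q)) p u)
    (Spacetime.coordVec (S.ι p) (mfderiv (𝓡 (n + 1)) (𝓡 (n + 2)) S.ι p w))
  + G.christoffel (S.ι p) (extChartAt (𝓡 (n + 2)) (S.ι p) (S.ι p))
    (Spacetime.coordVec (S.ι p) (mfderiv (𝓡 (n + 1)) (𝓡 (n + 2)) S.ι p u))
    (Spacetime.coordVec (S.ι p) (V p))
    (Spacetime.coordVec (S.ι p) (mfderiv (𝓡 (n + 1)) (𝓡 (n + 2)) S.ι p w))

/-- The expansion `θ_V = q^{ij} (B_V)_{ij}` at `p`: the trace, with respect to the induced metric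
`q` of the leaf through `p`, of the null extrinsic curvature, computed in a basis of the tangent
space of the leaf. -/
def expansion (S : FoliatedHypersurface G H)
    (V : ∀ p : H, TangentSpace (𝓡 (n + 2)) (S.ι p)) (p : H) : ℝ :=
  let b := Module.finBasis ℝ (S.leafTangent p)
  let q : Matrix (Fin (Module.finrank ℝ (S.leafTangent p)))
      (Fin (Module.finrank ℝ (S.leafTangent p))) ℝ :=
    Matrix.of fun i j ↦ S.inducedMetric p (b i).1 (b j).1
  ∑ i, ∑ j, q⁻¹ i j * S.nullExtrinsicCurvature V p (b i).1 (b j).1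

/-- Future holographic screen: all leaves are strictly marginally trapped. -/
def IsFutureScreen (S : FoliatedHypersurface G H) : Prop :=
  ∀ p : H, S.expansion S.k p = 0 ∧ S.expansion S.l p < 0

/-- Past holographic screen: all leaves are strictly marginally antitrapped. -/
def IsPastScreen (S : FoliatedHypersurface G H) : Prop :=
  ∀ p : H, S.expansion S.k p = 0 ∧ 0 < S.expansion S.l p

/-- The flow field `h = ∂_τ = α l + β k` of the foliation: the vector field tangent to `H`,
orthogonal to the leaves, with `dτ(h) = 1`. -/
structure Flow (S : FoliatedHypersurface G H) where
  h : ∀ p : H, TangentSpace (𝓡 (n + 1)) p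
  h_contMDiff : ContMDiff (𝓡 (n + 1)) (𝓡 (n + 1)).tangent 1
    (fun p ↦ (⟨p, h p⟩ : TangentBundle (𝓡 (n + 1)) H))
  h_τ : ∀ p : H, mfderiv (𝓡 (n + 1)) 𝓘(ℝ, ℝ) S.τ p (h p) = (1 : ℝ)
  α : H → ℝ
  β : H → ℝ
  h_eq : ∀ p : H, mfderiv (𝓡 (n + 1)) (𝓡 (n + 2)) S.ι p (h p) = α p • S.l p + β p • S.k p

/-- Local coordinates `(x¹, …, xⁿ, τ)` of class `C¹` on an open set of `H`, given by their inverse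
`Φ : (x, τ) ↦ p`, with `∂_τ = h`: the `xⁱ` are coordinates on each leaf, carried along by the
flow. -/
structure ComovingCoordinates {S : FoliatedHypersurface G H} (F : S.Flow) where
  Φ : OpenPartialHomeomorph (EuclideanSpace ℝ (Fin n) × ℝ) H
  Φ_contMDiffOn : ContMDiffOn 𝓘(ℝ, EuclideanSpace ℝ (Fin n) × ℝ) (𝓡 (n + 1)) 1 Φ Φ.source
  Φ_symm_contMDiffOn :
    ContMDiffOn (𝓡 (n + 1)) 𝓘(ℝ, EuclideanSpace ℝ (Fin n) × ℝ) 1 Φ.symm Φ.target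
  τ_eq : ∀ z ∈ Φ.source, S.τ (Φ z) = z.2
  flow_eq : ∀ z ∈ Φ.source,
    mfderiv 𝓘(ℝ, EuclideanSpace ℝ (Fin n) × ℝ) (𝓡 (n + 1)) Φ z
      ((0, 1) : EuclideanSpace ℝ (Fin n) × ℝ) = F.h (Φ z)

namespace ComovingCoordinates

variable {S : FoliatedHypersurface G H} {F : S.Flow}

/-- The coordinate vector `∂ / ∂xⁱ`, tangent to the leaf. -/
def coordField (C : ComovingCoordinates F) (z : EuclideanSpace ℝ (Fin n) × ℝ) (i : Fin n) :
    TangentSpace (𝓡 (n + 1)) (C.Φ z) :=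
  mfderiv 𝓘(ℝ, EuclideanSpace ℝ (Fin n) × ℝ) (𝓡 (n + 1)) C.Φ z
    ((EuclideanSpace.single i 1, 0) : EuclideanSpace ℝ (Fin n) × ℝ)

/-- The proper area element `δA = √(det q)` (relative to `dx¹ ⋯ dxⁿ`) of the leaf, where
`q_{ij}` are the components of the induced metric of the leaf in the coordinates `xⁱ`. -/
def areaElement (C : ComovingCoordinates F) (z : EuclideanSpace ℝ (Fin n) × ℝ) : ℝ :=
  Real.sqrt (Matrix.det (Matrix.of fun i j : Fin n ↦
    S.inducedMetric (C.Φ z) (C.coordField z i) (C.coordField z j)))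

/-- The fractional rate of change `(1/δA) d(δA)/dτ` of the area element along the flow. -/
def areaRate (C : ComovingCoordinates F) (x : EuclideanSpace ℝ (Fin n)) (t : ℝ) : ℝ :=
  1 / C.areaElement (x, t) * deriv (fun s ↦ C.areaElement (x, s)) t

end ComovingCoordinates

end FoliatedHypersurface

end

/-! The area element of a leaf is `√(det q)`, so by Jacobi's formula its logarithmic derivative
along the flow is `½ q^{ij} ∂_τ q_{ij}`. Read in a chart of the spacetime, the coordinates
`(x, τ)` turn the embedding into a map `f` with `q_{ij} = g (∂ᵢ f, ∂ⱼ f)` and `∂_τ f = α l + β k`.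
Exchanging the derivatives in `∂_τ ∂ᵢ f`, and using that `k` and `l` are orthogonal to the leaf,
one finds `∂_τ q_{ij} = α (B^l_{ij} + B^l_{ji}) + β (B^k_{ij} + B^k_{ji})` with the null extrinsic
curvatures `B^l`, `B^k` (`hasDerivAt_pullback_metric`). The trace gives
`d(δA)/dτ = δA (α θ_l + β θ_k)` on every foliated hypersurface
(`FoliatedHypersurface.ComovingCoordinates.hasDerivAt_areaElement`); on a screen `θ_k = 0`, and
the sign of `θ_l` decides the sign of the rate.

The coordinates are only of class `C¹`, so `f` has no second derivatives to exchange in general.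
What saves the argument is that `∂_τ f` is the field `h` in coordinates, which is `C¹`: this is
enough for `∂_τ ∂ᵢ f = ∂ᵢ ∂_τ f` (`hasDerivAt_fderiv_apply_of_hasStrictFDerivAt`). The remaining
ingredients are that the leaf metric is positive definite, because `k + l` is timelike, and that
the expansion may be computed in the coordinate basis instead of the basis used to define it
(`LinearMap.sum_inv_toMatrix₂_mul_eq`). -/

/-! ### Mixed partial derivatives, determinants and traces -/

open Filter Topology in
/-- Exchange of mixed partial derivatives under weak regularity: `f` need not be twice
differentiable, and its derivative need not even be continuous, but `∂ₜ f` is strictly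
differentiable at one point. There `∂ₜ ∂ᵥ f` exists and equals `∂ᵥ ∂ₜ f`. The proof compares the
second difference `f (x + e v, s) - f (x, s) - f (x + e v, t) + f (x, t)` with its linear part by
the mean value inequality in `s` and then lets `e` tend to zero. -/
theorem hasDerivAt_fderiv_apply_of_hasStrictFDerivAt {X E : Type*} [NormedAddCommGroup X]
    [NormedSpace ℝ X] [NormedAddCommGroup E] [NormedSpace ℝ E] {f W : X × ℝ → E}
    {W' : X × ℝ →L[ℝ] E} {x : X} {t : ℝ} (hf : ∀ᶠ z in 𝓝 (x, t), DifferentiableAt ℝ f z)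
    (hfW : ∀ᶠ z in 𝓝 (x, t), fderiv ℝ f z (0, 1) = W z)
    (hW : HasStrictFDerivAt W W' (x, t)) (v : X) :
    HasDerivAt (fun s ↦ fderiv ℝ f (x, s) (v, 0)) (W' (v, 0)) t := by
  rw [hasDerivAt_iff_isLittleO, Asymptotics.isLittleO_iff]
  intro ε hε
  -- a radius on which all the hypotheses hold and the increments of `W` are controlled
  obtain ⟨δ, hδ, hball⟩ : ∃ δ > 0, ∀ y s, dist y x < δ → dist s t < δ →
      DifferentiableAt ℝ f (y, s) ∧ fderiv ℝ f (y, s) (0, 1) = W (y, s) ∧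
      ‖W (y, s) - W (x, s) - W' ((y, s) - (x, s))‖ ≤ ε / (‖v‖ + 1) * ‖(y, s) - (x, s)‖ := by
    have h1 := hasStrictFDerivAt_iff_isLittleO.1 hW
    rw [Asymptotics.isLittleO_iff] at h1
    have h2 := h1 (show 0 < ε / (‖v‖ + 1) by positivity)
    obtain ⟨δ₁, hδ₁, H₁⟩ := Metric.eventually_nhds_iff.1 h2
    obtain ⟨δ₂, hδ₂, H₂⟩ := Metric.eventually_nhds_iff.1 (hf.and hfW)
    refine ⟨min δ₁ δ₂, lt_min hδ₁ hδ₂, fun y s hy hs ↦ ?_⟩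
    have h3 : dist (y, s) (x, t) < min δ₁ δ₂ := by
      rw [Prod.dist_eq]; exact max_lt hy hs
    have h4 : dist (x, s) (x, t) < min δ₁ δ₂ := by
      rw [Prod.dist_eq]; exact max_lt (by simpa using ⟨hδ₁, hδ₂⟩) hs
    refine ⟨(H₂ (h3.trans_le (min_le_right _ _))).1, (H₂ (h3.trans_le (min_le_right _ _))).2, ?_⟩
    refine @H₁ ((y, s), (x, s)) ?_
    rw [Prod.dist_eq]
    exact (max_lt h3 h4).trans_le (min_le_left _ _)
  -- the derivative of `f` in the direction `(v, 0)`, as a derivative along a line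
  have hline : ∀ s, dist s t < δ →
      HasDerivAt (fun e : ℝ ↦ f (x + e • v, s)) (fderiv ℝ f (x, s) (v, 0)) 0 := by
    intro s hs
    have h1 : HasDerivAt (fun e : ℝ ↦ (x + e • v, s)) (v, (0 : ℝ)) 0 := by
      refine HasDerivAt.prodMk ?_ (hasDerivAt_const _ _)
      simpa using ((hasDerivAt_id (0 : ℝ)).smul_const v).const_add x
    have h2 := (hball x s (by simpa using hδ) hs).1.hasFDerivAt
    refine HasFDerivAt.comp_hasDerivAt_of_eq (0 : ℝ) h2 h1 (by simp)
  filter_upwards [Metric.ball_mem_nhds t hδ] with s hs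
  have hder : HasDerivAt (fun e : ℝ ↦ f (x + e • v, s) - f (x + e • v, t) - (s - t) • W' (e • v, 0))
      (fderiv ℝ f (x, s) (v, 0) - fderiv ℝ f (x, t) (v, 0) - (s - t) • W' (v, 0)) 0 := by
    refine ((hline s hs).sub (hline t (by simpa using hδ))).sub (HasDerivAt.const_smul _ ?_)
    have : (fun e : ℝ ↦ W' (e • v, 0)) = fun e : ℝ ↦ e • W' (v, 0) := by
      funext e; rw [← map_smul]; simp
    rw [this]
    simpa using (hasDerivAt_id (0 : ℝ)).smul_const (W' (v, (0 : ℝ)))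
  refine hder.le_of_lip' (by positivity) ?_
  have hcont : Tendsto (fun e : ℝ ↦ x + e • v) (𝓝 0) (𝓝 x) := by
    have : Continuous (fun e : ℝ ↦ x + e • v) := by fun_prop
    simpa using this.tendsto 0
  filter_upwards [hcont (Metric.ball_mem_nhds x hδ)] with e he
  -- for fixed `e`, the second difference has a small derivative in the time variable
  have hseg : ∀ r ∈ Metric.ball t δ, HasDerivWithinAt
      (fun r ↦ f (x + e • v, r) - f (x, r) - (r - t) • W' (e • v, 0))
      (W (x + e • v, r) - W (x, r) - W' (e • v, 0)) (Metric.ball t δ) r := by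
    intro r hr
    have key : ∀ y, dist y x < δ → HasDerivAt (fun r ↦ f (y, r)) (W (y, r)) r := by
      intro y hy
      have h1 := hball y r hy hr
      rw [← h1.2.1]
      exact h1.1.hasFDerivAt.comp_hasDerivAt r ((hasDerivAt_const r y).prodMk (hasDerivAt_id r))
    refine (((key _ he).sub (key x (by simpa using hδ))).sub ?_).hasDerivWithinAt
    simpa using ((hasDerivAt_id r).sub_const t).smul_const (W' (e • v, (0 : ℝ)))
  have hmv := (convex_ball t δ).norm_image_sub_le_of_norm_hasDerivWithin_le
    (C := ε / (‖v‖ + 1) * ‖e • v‖) hseg (fun r hr ↦ ?_) (Metric.mem_ball_self hδ) hs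
  · have h0 : ‖v‖ / (‖v‖ + 1) ≤ 1 := by rw [div_le_one (by positivity)]; linarith
    calc _ = ‖f (x + e • v, s) - f (x, s) - (s - t) • W' (e • v, 0)
          - (f (x + e • v, t) - f (x, t) - (t - t) • W' (e • v, 0))‖ := by
            have h00 : W' ((0 : X), (0 : ℝ)) = 0 := W'.map_zero
            congr 1; simp [h00]; abel
      _ ≤ _ := hmv
      _ = (ε * ‖s - t‖) * (‖v‖ / (‖v‖ + 1)) * ‖e‖ := by rw [norm_smul]; ring
      _ ≤ (ε * ‖s - t‖) * 1 * ‖e‖ := by gcongr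
      _ = ε * ‖s - t‖ * ‖e - 0‖ := by rw [mul_one, sub_zero]
  · have h1 := (hball _ r he hr).2.2
    simpa [Prod.norm_def] using h1

/-- **Jacobi's formula** for the derivative of a determinant. -/
theorem Matrix.hasDerivAt_det {ι : Type*} [Fintype ι] [DecidableEq ι] {A : ℝ → Matrix ι ι ℝ}
    {A' : Matrix ι ι ℝ} {t : ℝ} (hA : ∀ i j, HasDerivAt (fun s ↦ A s i j) (A' i j) t) :
    HasDerivAt (fun s ↦ (A s).det) (∑ i, ∑ j, (A t).adjugate i j * A' j i) t := by
  have h1 : HasDerivAt (fun s ↦ (A s).det)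
      (∑ σ : Equiv.Perm ι, (σ.sign : ℤ) • ∑ i, (∏ j ∈ Finset.univ.erase i, A t (σ j) j) *
        A' (σ i) i) t := by
    simp only [Matrix.det_apply, Units.smul_def]
    refine HasDerivAt.fun_sum fun σ _ ↦ ?_
    have := HasDerivAt.fun_finsetProd (u := Finset.univ) (f := fun i s ↦ A s (σ i) i)
      (f' := fun i ↦ A' (σ i) i) (x := t) (fun i _ ↦ hA (σ i) i)
    simpa using this.const_mul ((σ.sign : ℤ) : ℝ)
  convert h1 using 1
  simp only [Finset.smul_sum]
  rw [Finset.sum_comm (s := (Finset.univ : Finset (Equiv.Perm ι)))]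
  refine Finset.sum_congr rfl fun i _ ↦ ?_
  have h2 : ∑ j, (A t).adjugate i j * A' j i = (Matrix.updateCol (A t) i fun j ↦ A' j i).det := by
    rw [← Matrix.cramer_apply, Matrix.cramer_eq_adjugate_mulVec]
    rfl
  rw [h2, Matrix.det_apply]
  refine Finset.sum_congr rfl fun σ _ ↦ ?_
  rw [Units.smul_def, ← Finset.mul_prod_erase _ _ (Finset.mem_univ i), mul_comm]
  congr 2
  · exact Finset.prod_congr rfl fun j hj ↦ by simp [Matrix.updateCol_ne (Finset.ne_of_mem_erase hj)]
  · simp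

theorem hasDerivAt_sqrt_det {ι : Type*} [Fintype ι] [DecidableEq ι] {A : ℝ → Matrix ι ι ℝ}
    {A' : Matrix ι ι ℝ} {t : ℝ} (hA : ∀ i j, HasDerivAt (fun s ↦ A s i j) (A' i j) t)
    (hpos : 0 < (A t).det) :
    HasDerivAt (fun s ↦ √(A s).det)
      (√(A t).det * ((1 / 2) * ∑ i, ∑ j, (A t)⁻¹ i j * A' j i)) t := by
  convert (Matrix.hasDerivAt_det hA).sqrt hpos.ne' using 1
  have h1 : ∑ i, ∑ j, (A t).adjugate i j * A' j i
      = (A t).det * ∑ i, ∑ j, (A t)⁻¹ i j * A' j i := by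
    simp only [Finset.mul_sum, Matrix.inv_def, Matrix.smul_apply, smul_eq_mul, ← mul_assoc,
      Ring.inverse_eq_inv', mul_inv_cancel₀ hpos.ne', one_mul]
  rw [h1]
  have h2 : √(A t).det ≠ 0 := (Real.sqrt_pos.2 hpos).ne'
  field_simp
  rw [Real.sq_sqrt hpos.le, mul_comm]

theorem LinearMap.sum_inv_toMatrix₂_mul {V ι : Type*} [AddCommGroup V] [Module ℝ V]
    [Fintype ι] [DecidableEq ι] (d : Module.Basis ι ℝ V) (q B : V →ₗ[ℝ] V →ₗ[ℝ] ℝ) :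
    ∑ i, ∑ j, (LinearMap.toMatrix₂ d d q)⁻¹ i j * B (d i) (d j)
      = ((LinearMap.toMatrix₂ d d q)⁻¹ * (LinearMap.toMatrix₂ d d B).transpose).trace := by
  simp [Matrix.trace, Matrix.mul_apply, LinearMap.toMatrix₂_apply]

/-- The trace `q^{ij} B_{ij}` of a bilinear form `B` with respect to a form `q`, nondegenerate in
one basis, does not depend on the basis. The two bases may have different index types. -/
theorem LinearMap.sum_inv_toMatrix₂_mul_eq {V ι κ : Type*} [AddCommGroup V] [Module ℝ V]
    [Fintype ι] [DecidableEq ι] [Fintype κ] [DecidableEq κ] (b : Module.Basis ι ℝ V)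
    (c : Module.Basis κ ℝ V) (q B : V →ₗ[ℝ] V →ₗ[ℝ] ℝ)
    (hq : (LinearMap.toMatrix₂ b b q).det ≠ 0) :
    ∑ i, ∑ j, (LinearMap.toMatrix₂ c c q)⁻¹ i j * B (c i) (c j)
      = ∑ i, ∑ j, (LinearMap.toMatrix₂ b b q)⁻¹ i j * B (b i) (b j) := by
  rw [LinearMap.sum_inv_toMatrix₂_mul, LinearMap.sum_inv_toMatrix₂_mul]
  set P := b.toMatrix c
  set R := c.toMatrix b
  have hRP : R * P = 1 := Module.Basis.toMatrix_mul_toMatrix_flip _ _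
  have hPR : P * R = 1 := Module.Basis.toMatrix_mul_toMatrix_flip _ _
  have hcq : P.transpose * LinearMap.toMatrix₂ b b q * P = LinearMap.toMatrix₂ c c q :=
    LinearMap.toMatrix₂_mul_basis_toMatrix b b c c q
  have hcB : P.transpose * LinearMap.toMatrix₂ b b B * P = LinearMap.toMatrix₂ c c B :=
    LinearMap.toMatrix₂_mul_basis_toMatrix b b c c B
  set Q := LinearMap.toMatrix₂ b b q
  have hinv : (LinearMap.toMatrix₂ c c q)⁻¹ = R * Q⁻¹ * R.transpose := by
    refine Matrix.inv_eq_left_inv ?_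
    rw [← hcq]
    calc R * Q⁻¹ * R.transpose * (P.transpose * Q * P)
        = R * (Q⁻¹ * ((P * R).transpose * Q)) * P := by
          rw [Matrix.transpose_mul]; simp only [Matrix.mul_assoc]
      _ = 1 := by
          rw [hPR, Matrix.transpose_one, Matrix.one_mul, Matrix.nonsing_inv_mul _ hq.isUnit,
            Matrix.mul_one, hRP]
  rw [hinv, ← hcB]
  simp only [Matrix.transpose_mul, Matrix.transpose_transpose]
  calc (R * Q⁻¹ * R.transpose * (P.transpose * ((LinearMap.toMatrix₂ b b B).transpose * P))).trace
      = (R * (Q⁻¹ * ((P * R).transpose * (LinearMap.toMatrix₂ b b B).transpose) * P)).trace := by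
        rw [Matrix.transpose_mul]; simp only [Matrix.mul_assoc]
    _ = _ := by
        rw [Matrix.trace_mul_comm, hPR, Matrix.transpose_one, Matrix.one_mul, Matrix.mul_assoc,
          hPR, Matrix.mul_one]

/-! ### First variation of an induced metric in coordinates -/

/-- The pairing `γ (∇ₐ V, c)` at a point of a coordinate space with metric `γ`, whose derivative
there is `γ'`: here `d` is the derivative in the direction `a` of the components of the field, `V`
its value, and the second summand is the Christoffel symbol of the first kind. -/
noncomputable def covariantPairing {E : Type*} [NormedAddCommGroup E] [NormedSpace ℝ E]
    (γ : E →L[ℝ] E →L[ℝ] ℝ) (γ' : E →L[ℝ] E →L[ℝ] E →L[ℝ] ℝ) (d V a c : E) : ℝ :=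
  γ d c + (1 / 2) * (γ' a V c + γ' V a c - γ' c a V)

open Filter Topology in
/-- First variation of the induced metric. If a family of maps `f` moves with the velocity
`a L + b K`, with `L` and `K` normal to the coordinate vectors `∂ᵤ f` and `∂_w f`, then the
component `γ (∂ᵤ f, ∂_w f)` changes at the rate given by the symmetrized extrinsic curvatures for
`L` and `K`. The derivatives of `a` and `b` drop out by orthogonality, and the Christoffel symbols
of the two terms add up to the derivative of `γ` along the velocity. -/
theorem hasDerivAt_pullback_metric {X E : Type*} [NormedAddCommGroup X]
    [NormedSpace ℝ X] [NormedAddCommGroup E] [NormedSpace ℝ E] {f L K : X × ℝ → E}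
    {a b : X × ℝ → ℝ} {x : X} {t : ℝ} {γ : E → E →L[ℝ] E →L[ℝ] ℝ}
    {γ' : E →L[ℝ] E →L[ℝ] E →L[ℝ] ℝ}
    (hf : ∀ᶠ z in 𝓝 (x, t), DifferentiableAt ℝ f z)
    (hfW : ∀ᶠ z in 𝓝 (x, t), fderiv ℝ f z (0, 1) = a z • L z + b z • K z)
    (hW : ContDiffAt ℝ 1 (fun z ↦ a z • L z + b z • K z) (x, t))
    (hL : DifferentiableAt ℝ L (x, t)) (hK : DifferentiableAt ℝ K (x, t))
    (ha : DifferentiableAt ℝ a (x, t)) (hb : DifferentiableAt ℝ b (x, t))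
    (hγ : HasFDerivAt γ γ' (f (x, t)))
    (hsymm : ∀ v w, γ (f (x, t)) v w = γ (f (x, t)) w v)
    (hsymm' : ∀ e v w, γ' e v w = γ' e w v) {u w : X}
    (hLu : γ (f (x, t)) (L (x, t)) (fderiv ℝ f (x, t) (u, 0)) = 0)
    (hLw : γ (f (x, t)) (L (x, t)) (fderiv ℝ f (x, t) (w, 0)) = 0)
    (hKu : γ (f (x, t)) (K (x, t)) (fderiv ℝ f (x, t) (u, 0)) = 0)
    (hKw : γ (f (x, t)) (K (x, t)) (fderiv ℝ f (x, t) (w, 0)) = 0) :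
    HasDerivAt (fun s ↦ γ (f (x, s)) (fderiv ℝ f (x, s) (u, 0)) (fderiv ℝ f (x, s) (w, 0)))
      (a (x, t) * (covariantPairing (γ (f (x, t))) γ' (fderiv ℝ L (x, t) (u, 0)) (L (x, t))
            (fderiv ℝ f (x, t) (u, 0)) (fderiv ℝ f (x, t) (w, 0))
          + covariantPairing (γ (f (x, t))) γ' (fderiv ℝ L (x, t) (w, 0)) (L (x, t))
            (fderiv ℝ f (x, t) (w, 0)) (fderiv ℝ f (x, t) (u, 0)))
        + b (x, t) * (covariantPairing (γ (f (x, t))) γ' (fderiv ℝ K (x, t) (u, 0)) (K (x, t))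
            (fderiv ℝ f (x, t) (u, 0)) (fderiv ℝ f (x, t) (w, 0))
          + covariantPairing (γ (f (x, t))) γ' (fderiv ℝ K (x, t) (w, 0)) (K (x, t))
            (fderiv ℝ f (x, t) (w, 0)) (fderiv ℝ f (x, t) (u, 0)))) t := by
  have hW' := hW.hasStrictFDerivAt one_ne_zero
  have hmixed := hasDerivAt_fderiv_apply_of_hasStrictFDerivAt hf hfW hW'
  have hWd : ∀ v : X, fderiv ℝ (fun z ↦ a z • L z + b z • K z) (x, t) (v, 0)
      = a (x, t) • fderiv ℝ L (x, t) (v, 0) + fderiv ℝ a (x, t) (v, 0) • L (x, t)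
        + (b (x, t) • fderiv ℝ K (x, t) (v, 0) + fderiv ℝ b (x, t) (v, 0) • K (x, t)) := by
    intro v
    have := ((ha.hasFDerivAt.smul hL.hasFDerivAt).add (hb.hasFDerivAt.smul hK.hasFDerivAt)).fderiv
    have h2 := congrArg (fun T : X × ℝ →L[ℝ] E ↦ T (v, 0)) this
    simpa using! h2
  have hcurve : HasDerivAt (fun s ↦ f (x, s)) (a (x, t) • L (x, t) + b (x, t) • K (x, t)) t := by
    rw [← hfW.self_of_nhds]
    exact hf.self_of_nhds.hasFDerivAt.comp_hasDerivAt t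
      ((hasDerivAt_const t x).prodMk (hasDerivAt_id t))
  have hγc := HasFDerivAt.comp_hasDerivAt (l := γ) (l' := γ') t hγ hcurve
  have h := (hγc.clm_apply (hmixed u)).clm_apply (hmixed w)
  refine h.congr_deriv ?_
  rw [hWd, hWd]
  have hLu' := hsymm _ _ ▸ hLu
  have hKu' := hsymm _ _ ▸ hKu
  generalize fderiv ℝ f (x, t) (u, 0) = U at *
  generalize fderiv ℝ f (x, t) (w, 0) = V at *
  simp only [covariantPairing, Function.comp_apply, map_add, map_smul, add_apply, smul_apply,
    smul_eq_mul, hLw, hKw, hLu', hKu']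
  rw [hsymm' U V (L (x, t)), hsymm' V U (L (x, t)), hsymm' U V (K (x, t)), hsymm' V U (K (x, t)),
    hsymm' (L (x, t)) V, hsymm' (K (x, t)) V, hsymm U, hsymm U]
  ring

/-! ### The spacetime metric in a chart -/

namespace Spacetime

variable {n : ℕ} {M : Type*} [TopologicalSpace M]
  [ChartedSpace (EuclideanSpace ℝ (Fin (n + 2))) M] [IsManifold (𝓡 (n + 2)) ∞ M]

/-- Inside the chart domain, the components of a vector are its fibre coordinate in the preferred
trivialization of the tangent bundle. -/
theorem coordVec_eq (x₀ : M) {x : M} (hx : x ∈ (chartAt (EuclideanSpace ℝ (Fin (n + 2))) x₀).source)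
    (v : TangentSpace (𝓡 (n + 2)) x) :
    coordVec x₀ v = (trivializationAt (EuclideanSpace ℝ (Fin (n + 2)))
      (TangentSpace (𝓡 (n + 2))) x₀ ⟨x, v⟩).2 := by
  have h := TangentBundle.continuousLinearMapAt_trivializationAt (I := 𝓡 (n + 2)) hx
  refine (DFunLike.congr_fun h v).symm.trans ?_
  set e := trivializationAt (EuclideanSpace ℝ (Fin (n + 2))) (TangentSpace (𝓡 (n + 2)) (M := M)) x₀
  refine (congrFun (e.continuousLinearMapAt_apply ℝ x) v).trans ?_
  exact congrFun (e.coe_linearMapAt_of_mem (by simpa [e] using hx)) v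

theorem contMDiffAt_coordVec {m : ℕ} {N : Type*} [TopologicalSpace N]
    [ChartedSpace (EuclideanSpace ℝ (Fin m)) N] {r : ℕ∞} {ι : N → M}
    {V : ∀ q : N, TangentSpace (𝓡 (n + 2)) (ι q)} {p : N}
    (hV : ContMDiffAt (𝓡 m) (𝓡 (n + 2)).tangent r
      (fun q ↦ (⟨ι q, V q⟩ : TangentBundle (𝓡 (n + 2)) M)) p) :
    ContMDiffAt (𝓡 m) 𝓘(ℝ, EuclideanSpace ℝ (Fin (n + 2))) r
      (fun q ↦ coordVec (ι p) (V q)) p := by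
  have h := Bundle.contMDiffAt_totalSpace.1 hV
  refine h.2.congr_of_eventuallyEq ?_
  filter_upwards [h.1.continuousAt (chart_source_mem_nhds (EuclideanSpace ℝ (Fin (n + 2))) (ι p))]
    with q hq
  exact coordVec_eq _ hq _

theorem coordMetric_add_left (G : Spacetime n M) (x₀ : M)
    (y a b c : EuclideanSpace ℝ (Fin (n + 2))) :
    G.coordMetric x₀ y (a + b) c = G.coordMetric x₀ y a c + G.coordMetric x₀ y b c := by
  unfold coordMetric
  refine (congrArg (fun v ↦ G.g ((extChartAt (𝓡 (n + 2)) x₀).symm y) v _)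
    ((mfderiv _ _ _ _).map_add a b)).trans ?_
  simp only [map_add, add_apply]

theorem coordMetric_smul_left (G : Spacetime n M) (x₀ : M) (r : ℝ)
    (y a b : EuclideanSpace ℝ (Fin (n + 2))) :
    G.coordMetric x₀ y (r • a) b = r • G.coordMetric x₀ y a b := by
  unfold coordMetric
  refine (congrArg (fun v ↦ G.g ((extChartAt (𝓡 (n + 2)) x₀).symm y) v _)
    ((mfderiv _ _ _ _).map_smul r a)).trans ?_
  simp only [map_smul, smul_apply]

theorem coordMetric_comm (G : Spacetime n M) (x₀ : M) (y a b : EuclideanSpace ℝ (Fin (n + 2))) :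
    G.coordMetric x₀ y a b = G.coordMetric x₀ y b a :=
  G.g_symm _ _ _

/-- The metric in the chart around `x₀`, as a function of the coordinate point with values in the
continuous bilinear forms. -/
noncomputable def coordMetricCLM (G : Spacetime n M) (x₀ : M) (y : EuclideanSpace ℝ (Fin (n + 2))) :
    EuclideanSpace ℝ (Fin (n + 2)) →L[ℝ] EuclideanSpace ℝ (Fin (n + 2)) →L[ℝ] ℝ :=
  LinearMap.toContinuousBilinearMap (LinearMap.mk₂ ℝ (G.coordMetric x₀ y)
    (G.coordMetric_add_left x₀ y) (fun r ↦ G.coordMetric_smul_left x₀ r y)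
    (fun a b c ↦ by
      rw [coordMetric_comm, coordMetric_add_left, coordMetric_comm _ _ _ b,
        coordMetric_comm _ _ _ c])
    (fun r a b ↦ by
      rw [coordMetric_comm, coordMetric_smul_left, coordMetric_comm]))

theorem coordMetricCLM_apply (G : Spacetime n M) (x₀ : M) (y a b : EuclideanSpace ℝ (Fin (n + 2))) :
    G.coordMetricCLM x₀ y a b = G.coordMetric x₀ y a b := rfl

theorem contDiffAt_coordMetric (G : Spacetime n M) (x₀ : M) {y : EuclideanSpace ℝ (Fin (n + 2))}
    (hy : y ∈ (extChartAt (𝓡 (n + 2)) x₀).target) (a b : EuclideanSpace ℝ (Fin (n + 2))) :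
    ContDiffAt ℝ 1 (fun y ↦ G.coordMetric x₀ y a b) y := by
  have hsymm := contMDiffOn_extChartAt_symm (I := 𝓡 (n + 2)) (n := ∞) x₀
  have hopen := isOpen_extChartAt_target (I := 𝓡 (n + 2)) x₀
  have hsy := (hsymm y hy).contMDiffAt (hopen.mem_nhds hy)
  have hvec : ∀ v : EuclideanSpace ℝ (Fin (n + 2)),
      ContMDiffAt 𝓘(ℝ, EuclideanSpace ℝ (Fin (n + 2))) (𝓡 (n + 2)).tangent 1
      (fun y ↦ (⟨(extChartAt (𝓡 (n + 2)) x₀).symm y,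
        mfderiv 𝓘(ℝ, EuclideanSpace ℝ (Fin (n + 2))) (𝓡 (n + 2))
          (extChartAt (𝓡 (n + 2)) x₀).symm y v⟩ : TangentBundle (𝓡 (n + 2)) M)) y := by
    intro v
    -- the tangent map of the inverse chart, applied to a constant vector field
    have h1 : ContMDiffAt 𝓘(ℝ, EuclideanSpace ℝ (Fin (n + 2)))
        𝓘(ℝ, EuclideanSpace ℝ (Fin (n + 2))).tangent 1
        (fun y ↦ (⟨y, v⟩ : TangentBundle 𝓘(ℝ, EuclideanSpace ℝ (Fin (n + 2)))
          (EuclideanSpace ℝ (Fin (n + 2))))) y :=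
      contMDiffAt_vectorSpace_iff_contDiffAt.2 contDiffAt_const
    have h2 := hsymm.contMDiffOn_tangentMapWithin (m := 1) (by norm_cast) hopen.uniqueMDiffOn
    have h3 := (h2 ⟨y, v⟩ hy).contMDiffAt
      ((hopen.preimage (FiberBundle.continuous_proj _ _)).mem_nhds hy)
    refine (h3.comp y h1).congr_of_eventuallyEq ?_
    filter_upwards [hopen.mem_nhds hy] with y' hy'
    simp only [tangentMapWithin, Function.comp_apply, mfderivWithin_of_isOpen hopen hy']
  have hg : ContMDiffAt 𝓘(ℝ, EuclideanSpace ℝ (Fin (n + 2))) _ 1 _ y :=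
    (G.g_smooth.contMDiffAt.of_le (by norm_cast)).comp y (hsy.of_le (by norm_cast))
  have := ContMDiffAt.clm_bundle_apply₂ (F₁ := EuclideanSpace ℝ (Fin (n + 2)))
    (F₂ := EuclideanSpace ℝ (Fin (n + 2))) (F₃ := ℝ) (E₃ := fun _ : M ↦ ℝ) hg (hvec a) (hvec b)
  have h2 := (Bundle.contMDiffAt_totalSpace.1 this).2
  exact h2.contDiffAt

theorem differentiableAt_coordMetricCLM (G : Spacetime n M) (x₀ : M)
    {y : EuclideanSpace ℝ (Fin (n + 2))} (hy : y ∈ (extChartAt (𝓡 (n + 2)) x₀).target) :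
    DifferentiableAt ℝ (G.coordMetricCLM x₀) y := by
  have : ContDiffOn ℝ 1 (G.coordMetricCLM x₀) (extChartAt (𝓡 (n + 2)) x₀).target := by
    refine contDiffOn_clm_apply.2 fun a ↦ contDiffOn_clm_apply.2 fun b y hy ↦ ?_
    exact (G.contDiffAt_coordMetric x₀ hy a b).contDiffWithinAt
  exact (this.contDiffAt ((isOpen_extChartAt_target x₀).mem_nhds hy)).differentiableAt one_ne_zero

theorem fderiv_coordMetric (G : Spacetime n M) (x₀ : M)
    {y : EuclideanSpace ℝ (Fin (n + 2))} (hy : y ∈ (extChartAt (𝓡 (n + 2)) x₀).target)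
    (a b c : EuclideanSpace ℝ (Fin (n + 2))) :
    fderiv ℝ (fun y' ↦ G.coordMetric x₀ y' b c) y a
      = fderiv ℝ (G.coordMetricCLM x₀) y a b c := by
  have h := (G.differentiableAt_coordMetricCLM x₀ hy).hasFDerivAt
  have h2 := (h.clm_apply (hasFDerivAt_const b y)).clm_apply (hasFDerivAt_const c y)
  have h3 := congrArg (fun T : EuclideanSpace ℝ (Fin (n + 2)) →L[ℝ] ℝ ↦ T a) h2.fderiv
  simpa [coordMetricCLM_apply] using! h3

theorem coordMetric_coordVec (G : Spacetime n M) (x₀ : M) {x : M}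
    (hx : x ∈ (extChartAt (𝓡 (n + 2)) x₀).source) (v w : TangentSpace (𝓡 (n + 2)) x) :
    G.coordMetric x₀ (extChartAt (𝓡 (n + 2)) x₀ x) (coordVec x₀ v) (coordVec x₀ w)
      = G.g x v w := by
  have h := mfderivWithin_extChartAt_symm_comp_mfderiv_extChartAt' (I := 𝓡 (n + 2)) hx
  have key : ∀ u : TangentSpace (𝓡 (n + 2)) x,
      mfderiv 𝓘(ℝ, EuclideanSpace ℝ (Fin (n + 2))) (𝓡 (n + 2))
      (extChartAt (𝓡 (n + 2)) x₀).symm (extChartAt (𝓡 (n + 2)) x₀ x) (coordVec x₀ u) = u := by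
    intro u
    have h2 := DFunLike.congr_fun h u
    simpa [coordVec] using! h2
  unfold coordMetric
  rw [key, key, (extChartAt (𝓡 (n + 2)) x₀).left_inv hx]

end Spacetime

/-! ### The geometry of the leaves -/

/-- The vectors orthogonal to any timelike vector `T`, not only to the one that defines the time
orientation, are spacelike. -/
theorem Spacetime.pos_of_orthogonal_timelike {n : ℕ} {M : Type*} [TopologicalSpace M]
    [ChartedSpace (EuclideanSpace ℝ (Fin (n + 2))) M] [IsManifold (𝓡 (n + 2)) ∞ M]
    (G : Spacetime n M) {x : M} {T v : TangentSpace (𝓡 (n + 2)) x} (hT : G.g x T T < 0)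
    (hv : v ≠ 0) (hTv : G.g x T v = 0) : 0 < G.g x v v := by
  by_contra! hneg
  -- no combination of `v` and `T` has positive square, so one orthogonal to the time orientation
  -- has to vanish
  have hcomb : ∀ a b : ℝ, G.g x (G.T x) (a • v + b • T) = 0 → a • v + b • T = 0 := by
    intro a b hab
    by_contra hne
    have := G.pos_of_orthogonal x _ hne hab
    simp only [map_add, map_smul, add_apply, smul_apply, smul_eq_mul, G.g_symm x v T, hTv] at this
    nlinarith [mul_nonneg (sq_nonneg a) (neg_nonneg.2 hneg),
      mul_nonneg (sq_nonneg b) (neg_nonneg.2 hT.le)]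
  have h1 := hcomb (G.g x (G.T x) T) (-G.g x (G.T x) v) (by
    simp only [map_add, map_smul, smul_eq_mul]; ring)
  have h2 : G.g x (G.T x) v * G.g x T T = 0 := by
    have := congrArg (G.g x T) h1
    simpa [hTv] using! this
  have h3 : G.g x (G.T x) v = 0 := by simpa [hT.ne] using h2
  have h4 : v = 0 := by simpa using! hcomb 1 0 (by simpa using! h3)
  exact hv h4

namespace FoliatedHypersurface

variable {n : ℕ} {M : Type*} [TopologicalSpace M]
  [ChartedSpace (EuclideanSpace ℝ (Fin (n + 2))) M] [IsManifold (𝓡 (n + 2)) ∞ M]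
  {G : Spacetime n M} {H : Type*} [TopologicalSpace H]
  [ChartedSpace (EuclideanSpace ℝ (Fin (n + 1))) H] [IsManifold (𝓡 (n + 1)) 2 H]

/-- The leaves are spacelike, because their tangent vectors are orthogonal to the timelike vector
`k + l`. -/
theorem inducedMetric_pos (S : FoliatedHypersurface G H) {p : H}
    {u : TangentSpace (𝓡 (n + 1)) p} (hu : mfderiv (𝓡 (n + 1)) 𝓘(ℝ, ℝ) S.τ p u = 0)
    (hu0 : u ≠ 0) : 0 < S.inducedMetric p u u := by
  refine G.pos_of_orthogonal_timelike (T := S.k p + S.l p) ?_ ?_ ?_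
  · simp only [map_add, add_apply, S.k_null, S.l_null, S.k_l, G.g_symm _ (S.l p) (S.k p)]
    norm_num
  · exact fun h ↦ hu0 (S.ι_immersion p (h.trans (map_zero _).symm))
  · simp only [map_add, add_apply, S.k_orthogonal p u hu, S.l_orthogonal p u hu, add_zero]

/-- The derivative at `p` of the embedding, read in the chart of the spacetime around `x₀`. -/
noncomputable def tangentCoord (S : FoliatedHypersurface G H) (x₀ : M) (p : H) :
    EuclideanSpace ℝ (Fin (n + 1)) →L[ℝ] EuclideanSpace ℝ (Fin (n + 2)) :=
  (mfderiv (𝓡 (n + 2)) 𝓘(ℝ, EuclideanSpace ℝ (Fin (n + 2))) (extChartAt (𝓡 (n + 2)) x₀)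
    (S.ι p)).comp (mfderiv (𝓡 (n + 1)) (𝓡 (n + 2)) S.ι p)

theorem tangentCoord_apply (S : FoliatedHypersurface G H) (x₀ : M) (p : H)
    (u : EuclideanSpace ℝ (Fin (n + 1))) :
    S.tangentCoord x₀ p u
      = Spacetime.coordVec x₀ (mfderiv (𝓡 (n + 1)) (𝓡 (n + 2)) S.ι p u) := rfl

/-- The derivative at `p` of the components of a spacetime vector field `V` along `H`, in the chart
around `ι p`. -/
noncomputable def sectionDeriv (S : FoliatedHypersurface G H)
    (V : ∀ p : H, TangentSpace (𝓡 (n + 2)) (S.ι p)) (p : H) :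
    EuclideanSpace ℝ (Fin (n + 1)) →L[ℝ] EuclideanSpace ℝ (Fin (n + 2)) :=
  mfderiv (𝓡 (n + 1)) 𝓘(ℝ, EuclideanSpace ℝ (Fin (n + 2)))
    (fun q ↦ Spacetime.coordVec (S.ι p) (V q)) p

theorem inducedMetric_eq (S : FoliatedHypersurface G H) (x₀ : M) {p : H}
    (hp : S.ι p ∈ (extChartAt (𝓡 (n + 2)) x₀).source) (u w : EuclideanSpace ℝ (Fin (n + 1))) :
    S.inducedMetric p u w = G.coordMetricCLM x₀ (extChartAt (𝓡 (n + 2)) x₀ (S.ι p))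
      (S.tangentCoord x₀ p u) (S.tangentCoord x₀ p w) :=
  (G.coordMetric_coordVec x₀ hp _ _).symm

theorem nullExtrinsicCurvature_eq (S : FoliatedHypersurface G H)
    (V : ∀ p : H, TangentSpace (𝓡 (n + 2)) (S.ι p)) (p : H)
    (u w : EuclideanSpace ℝ (Fin (n + 1))) :
    S.nullExtrinsicCurvature V p u w =
      covariantPairing (G.coordMetricCLM (S.ι p) (extChartAt (𝓡 (n + 2)) (S.ι p) (S.ι p)))
        (fderiv ℝ (G.coordMetricCLM (S.ι p)) (extChartAt (𝓡 (n + 2)) (S.ι p) (S.ι p)))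
        (S.sectionDeriv V p u) (Spacetime.coordVec (S.ι p) (V p)) (S.tangentCoord (S.ι p) p u)
        (S.tangentCoord (S.ι p) p w) := by
  have hy := mem_extChartAt_target (I := 𝓡 (n + 2)) (S.ι p)
  unfold nullExtrinsicCurvature Spacetime.christoffel
  rw [G.fderiv_coordMetric _ hy, G.fderiv_coordMetric _ hy, G.fderiv_coordMetric _ hy]
  rfl

/-- The induced metric of the leaf through `p`, as a bilinear form on its tangent space. -/
noncomputable def inducedForm (S : FoliatedHypersurface G H) (p : H) :
    S.leafTangent p →ₗ[ℝ] S.leafTangent p →ₗ[ℝ] ℝ :=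
  LinearMap.mk₂ ℝ (fun u w ↦ S.inducedMetric p u.1 w.1)
    (fun u v w ↦ by simp [S.inducedMetric_eq _ (mem_extChartAt_source (I := 𝓡 (n + 2)) (S.ι p))])
    (fun r u w ↦ by simp [S.inducedMetric_eq _ (mem_extChartAt_source (I := 𝓡 (n + 2)) (S.ι p))])
    (fun u v w ↦ by simp [S.inducedMetric_eq _ (mem_extChartAt_source (I := 𝓡 (n + 2)) (S.ι p))])
    (fun r u w ↦ by simp [S.inducedMetric_eq _ (mem_extChartAt_source (I := 𝓡 (n + 2)) (S.ι p))])

/-- The extrinsic curvature of the leaf through `p` in the direction `V`, as a bilinear form on its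
tangent space. -/
noncomputable def curvatureForm (S : FoliatedHypersurface G H)
    (V : ∀ p : H, TangentSpace (𝓡 (n + 2)) (S.ι p)) (p : H) :
    S.leafTangent p →ₗ[ℝ] S.leafTangent p →ₗ[ℝ] ℝ :=
  LinearMap.mk₂ ℝ (fun u w ↦ S.nullExtrinsicCurvature V p u.1 w.1)
    (fun u v w ↦ by
      rw [S.nullExtrinsicCurvature_eq, S.nullExtrinsicCurvature_eq, S.nullExtrinsicCurvature_eq]
      simp [covariantPairing]; ring)
    (fun r u w ↦ by
      rw [S.nullExtrinsicCurvature_eq, S.nullExtrinsicCurvature_eq]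
      simp [covariantPairing]; ring)
    (fun u v w ↦ by
      rw [S.nullExtrinsicCurvature_eq, S.nullExtrinsicCurvature_eq, S.nullExtrinsicCurvature_eq]
      simp [covariantPairing]; ring)
    (fun r u w ↦ by
      rw [S.nullExtrinsicCurvature_eq, S.nullExtrinsicCurvature_eq]
      simp [covariantPairing]; ring)

theorem posDef_toMatrix₂_inducedForm (S : FoliatedHypersurface G H) (p : H) {κ : Type*} [Fintype κ]
    [DecidableEq κ] (c : Module.Basis κ ℝ (S.leafTangent p)) :
    (LinearMap.toMatrix₂ c c (S.inducedForm p)).PosDef := by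
  refine Matrix.PosDef.of_dotProduct_mulVec_pos ?_ fun y hy ↦ ?_
  · ext i j
    simp only [Matrix.conjTranspose_apply, LinearMap.toMatrix₂_apply, star_trivial]
    exact G.g_symm _ _ _
  · have h0 : ∑ i, y i • c i ≠ 0 := by
      intro h
      exact hy (funext fun i ↦ Fintype.linearIndependent_iff.1 c.linearIndependent y h i)
    have h1 : 0 < S.inducedForm p (∑ i, y i • c i) (∑ i, y i • c i) :=
      S.inducedMetric_pos (∑ i, y i • c i : S.leafTangent p).2 (fun h ↦ h0 (Subtype.ext h))
    refine h1.trans_eq ?_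
    simp only [map_sum, map_smul, LinearMap.sum_apply, LinearMap.smul_apply, smul_eq_mul,
      dotProduct, Matrix.mulVec, LinearMap.toMatrix₂_apply, star_trivial, Finset.mul_sum]
    rw [Finset.sum_comm]
    refine Finset.sum_congr rfl fun i _ ↦ Finset.sum_congr rfl fun j _ ↦ ?_
    ring

theorem expansion_eq_sum (S : FoliatedHypersurface G H)
    (V : ∀ p : H, TangentSpace (𝓡 (n + 2)) (S.ι p)) (p : H) {κ : Type*} [Fintype κ]
    [DecidableEq κ] (c : Module.Basis κ ℝ (S.leafTangent p)) :
    S.expansion V p = ∑ i, ∑ j, (LinearMap.toMatrix₂ c c (S.inducedForm p))⁻¹ i j *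
      S.nullExtrinsicCurvature V p (c i).1 (c j).1 := by
  have h := LinearMap.sum_inv_toMatrix₂_mul_eq c (Module.finBasis ℝ (S.leafTangent p))
    (S.inducedForm p) (S.curvatureForm V p) (S.posDef_toMatrix₂_inducedForm p c).det_pos.ne'
  have hq : LinearMap.toMatrix₂ (Module.finBasis ℝ (S.leafTangent p))
      (Module.finBasis ℝ (S.leafTangent p)) (S.inducedForm p)
      = Matrix.of fun i j ↦ S.inducedMetric p (Module.finBasis ℝ (S.leafTangent p) i).1
        (Module.finBasis ℝ (S.leafTangent p) j).1 := by
    ext i j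
    exact LinearMap.toMatrix₂_apply ..
  rw [hq] at h
  exact h

end FoliatedHypersurface

/-! ### The area element in comoving coordinates -/

namespace FoliatedHypersurface.ComovingCoordinates

variable {n : ℕ} {M : Type*} [TopologicalSpace M]
  [ChartedSpace (EuclideanSpace ℝ (Fin (n + 2))) M] [IsManifold (𝓡 (n + 2)) ∞ M]
  {G : Spacetime n M} {H : Type*} [TopologicalSpace H]
  [ChartedSpace (EuclideanSpace ℝ (Fin (n + 1))) H] [IsManifold (𝓡 (n + 1)) 2 H]
  {S : FoliatedHypersurface G H} {F : S.Flow} (C : ComovingCoordinates F)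

/-- The derivative at `z` of the parametrization `(x, τ) ↦ p`. -/
noncomputable def tangentMapAt (z : EuclideanSpace ℝ (Fin n) × ℝ) :
    EuclideanSpace ℝ (Fin n) × ℝ →L[ℝ] EuclideanSpace ℝ (Fin (n + 1)) :=
  mfderiv 𝓘(ℝ, EuclideanSpace ℝ (Fin n) × ℝ) (𝓡 (n + 1)) C.Φ z

theorem mdifferentiable :
    C.Φ.MDifferentiable 𝓘(ℝ, EuclideanSpace ℝ (Fin n) × ℝ) (𝓡 (n + 1)) :=
  ⟨C.Φ_contMDiffOn.mdifferentiableOn one_ne_zero,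
    C.Φ_symm_contMDiffOn.mdifferentiableOn one_ne_zero⟩

theorem bijective_tangentMapAt {z : EuclideanSpace ℝ (Fin n) × ℝ} (hz : z ∈ C.Φ.source) :
    Function.Bijective (C.tangentMapAt z) :=
  C.mdifferentiable.mfderiv_bijective hz

theorem mfderiv_τ_tangentMapAt {z : EuclideanSpace ℝ (Fin n) × ℝ} (hz : z ∈ C.Φ.source)
    (v : EuclideanSpace ℝ (Fin n) × ℝ) :
    mfderiv (𝓡 (n + 1)) 𝓘(ℝ, ℝ) S.τ (C.Φ z) (C.tangentMapAt z v) = v.2 := by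
  have h1 : HasMFDerivAt 𝓘(ℝ, EuclideanSpace ℝ (Fin n) × ℝ) 𝓘(ℝ, ℝ) (S.τ ∘ C.Φ) z
      ((mfderiv (𝓡 (n + 1)) 𝓘(ℝ, ℝ) S.τ (C.Φ z)).comp (C.tangentMapAt z)) :=
    HasMFDerivAt.comp z ((S.τ_contMDiff.mdifferentiable two_ne_zero) _).hasMFDerivAt
      (C.mdifferentiable.mdifferentiableAt hz).hasMFDerivAt
  have h2 : HasFDerivAt (S.τ ∘ C.Φ)
      (ContinuousLinearMap.snd ℝ (EuclideanSpace ℝ (Fin n)) ℝ) z := by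
    refine hasFDerivAt_snd.congr_of_eventuallyEq ?_
    filter_upwards [C.Φ.open_source.mem_nhds hz] with y hy using C.τ_eq y hy
  exact DFunLike.congr_fun (hasMFDerivAt_unique h1 h2.hasMFDerivAt) v

/-- The parametrization identifies the `x`-space with the tangent space of the leaf. -/
noncomputable def leafEquiv {z : EuclideanSpace ℝ (Fin n) × ℝ} (hz : z ∈ C.Φ.source) :
    EuclideanSpace ℝ (Fin n) ≃ₗ[ℝ] S.leafTangent (C.Φ z) :=
  LinearEquiv.ofBijective
    (LinearMap.codRestrict (S.leafTangent (C.Φ z))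
      ((C.tangentMapAt z).toLinearMap ∘ₗ LinearMap.inl ℝ (EuclideanSpace ℝ (Fin n)) ℝ)
      (fun v ↦ C.mfderiv_τ_tangentMapAt hz (v, 0)))
    ⟨fun v w h ↦ congrArg Prod.fst
        ((C.bijective_tangentMapAt hz).1 (a₁ := (v, (0 : ℝ))) (a₂ := (w, 0))
          (congrArg Subtype.val h)),
      fun ⟨u, hu⟩ ↦ by
        obtain ⟨⟨v, r⟩, rfl⟩ := (C.bijective_tangentMapAt hz).2 u
        obtain rfl : r = 0 := (C.mfderiv_τ_tangentMapAt hz (v, r)).symm.trans hu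
        exact ⟨v, rfl⟩⟩

/-- The basis `∂ / ∂xⁱ` of the tangent space of the leaf. -/
noncomputable def coordBasis {z : EuclideanSpace ℝ (Fin n) × ℝ} (hz : z ∈ C.Φ.source) :
    Module.Basis (Fin n) ℝ (S.leafTangent (C.Φ z)) :=
  (EuclideanSpace.basisFun (Fin n) ℝ).toBasis.map (C.leafEquiv hz)

theorem coe_coordBasis {z : EuclideanSpace ℝ (Fin n) × ℝ} (hz : z ∈ C.Φ.source) (i : Fin n) :
    (C.coordBasis hz i : EuclideanSpace ℝ (Fin (n + 1))) = C.coordField z i := by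
  rw [coordBasis, Module.Basis.map_apply, OrthonormalBasis.coe_toBasis,
    EuclideanSpace.basisFun_apply]
  rfl

theorem toMatrix₂_coordBasis {z : EuclideanSpace ℝ (Fin n) × ℝ} (hz : z ∈ C.Φ.source) :
    LinearMap.toMatrix₂ (C.coordBasis hz) (C.coordBasis hz) (S.inducedForm (C.Φ z))
      = Matrix.of fun i j ↦ S.inducedMetric (C.Φ z) (C.coordField z i) (C.coordField z j) := by
  ext i j
  rw [LinearMap.toMatrix₂_apply, Matrix.of_apply, ← C.coe_coordBasis hz, ← C.coe_coordBasis hz]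
  rfl

theorem posDef_metric {z : EuclideanSpace ℝ (Fin n) × ℝ} (hz : z ∈ C.Φ.source) :
    (Matrix.of fun i j ↦
      S.inducedMetric (C.Φ z) (C.coordField z i) (C.coordField z j)).PosDef :=
  C.toMatrix₂_coordBasis hz ▸ S.posDef_toMatrix₂_inducedForm _ (C.coordBasis hz)

theorem areaElement_pos {z : EuclideanSpace ℝ (Fin n) × ℝ} (hz : z ∈ C.Φ.source) :
    0 < C.areaElement z :=
  Real.sqrt_pos.2 (C.posDef_metric hz).det_pos

theorem expansion_eq_sum_coordField {z : EuclideanSpace ℝ (Fin n) × ℝ} (hz : z ∈ C.Φ.source)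
    (V : ∀ p : H, TangentSpace (𝓡 (n + 2)) (S.ι p)) :
    S.expansion V (C.Φ z) = ∑ i, ∑ j, (Matrix.of fun i j ↦
        S.inducedMetric (C.Φ z) (C.coordField z i) (C.coordField z j))⁻¹ i j *
      S.nullExtrinsicCurvature V (C.Φ z) (C.coordField z i) (C.coordField z j) := by
  rw [S.expansion_eq_sum V (C.Φ z) (C.coordBasis hz), C.toMatrix₂_coordBasis hz]
  simp only [C.coe_coordBasis hz]

/-- The embedding of `H` as a function of the coordinates `(x, τ)`, read in the chart of the
spacetime around `x₀`. -/
noncomputable def chartMap (x₀ : M) (z : EuclideanSpace ℝ (Fin n) × ℝ) :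
    EuclideanSpace ℝ (Fin (n + 2)) :=
  extChartAt (𝓡 (n + 2)) x₀ (S.ι (C.Φ z))

theorem hasFDerivAt_chartMap {x₀ : M} {z : EuclideanSpace ℝ (Fin n) × ℝ} (hz : z ∈ C.Φ.source)
    (hx : S.ι (C.Φ z) ∈ (extChartAt (𝓡 (n + 2)) x₀).source) :
    HasFDerivAt (C.chartMap x₀) ((S.tangentCoord x₀ (C.Φ z)).comp (C.tangentMapAt z)) z := by
  rw [extChartAt_source] at hx
  have h1 := (mdifferentiableAt_extChartAt (I := 𝓡 (n + 2)) hx).hasMFDerivAt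
  have h2 := ((S.ι_contMDiff.mdifferentiable two_ne_zero) (C.Φ z)).hasMFDerivAt
  have h3 := (C.mdifferentiable.mdifferentiableAt hz).hasMFDerivAt
  exact (HasMFDerivAt.comp z (HasMFDerivAt.comp (C.Φ z) h1 h2) h3).hasFDerivAt

theorem eventually_mem_source {z : EuclideanSpace ℝ (Fin n) × ℝ} (hz : z ∈ C.Φ.source) :
    ∀ᶠ y in nhds z, y ∈ C.Φ.source ∧
      S.ι (C.Φ y) ∈ (extChartAt (𝓡 (n + 2)) (S.ι (C.Φ z))).source :=
  Filter.inter_mem (C.Φ.open_source.mem_nhds hz) <|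
    ((S.ι_contMDiff.continuous.continuousAt (x := C.Φ z)).comp (C.Φ.continuousAt hz))
      (extChartAt_source_mem_nhds (I := 𝓡 (n + 2)) (S.ι (C.Φ z)))

theorem contDiffAt_coordVec {z : EuclideanSpace ℝ (Fin n) × ℝ} (hz : z ∈ C.Φ.source)
    {V : ∀ p : H, TangentSpace (𝓡 (n + 2)) (S.ι p)}
    (hV : ContMDiff (𝓡 (n + 1)) (𝓡 (n + 2)).tangent 1
      (fun p ↦ (⟨S.ι p, V p⟩ : TangentBundle (𝓡 (n + 2)) M))) :
    ContDiffAt ℝ 1 (fun y ↦ Spacetime.coordVec (S.ι (C.Φ z)) (V (C.Φ y))) z := by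
  have h1 := Spacetime.contMDiffAt_coordVec (r := 1) (hV (C.Φ z))
  have h2 := C.Φ_contMDiffOn.contMDiffAt (C.Φ.open_source.mem_nhds hz)
  exact (ContMDiffAt.comp z h1 h2).contDiffAt

theorem hasFDerivAt_coordVec {z : EuclideanSpace ℝ (Fin n) × ℝ} (hz : z ∈ C.Φ.source)
    {V : ∀ p : H, TangentSpace (𝓡 (n + 2)) (S.ι p)}
    (hV : ContMDiff (𝓡 (n + 1)) (𝓡 (n + 2)).tangent 1
      (fun p ↦ (⟨S.ι p, V p⟩ : TangentBundle (𝓡 (n + 2)) M))) :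
    HasFDerivAt (fun y ↦ Spacetime.coordVec (S.ι (C.Φ z)) (V (C.Φ y)))
      ((S.sectionDeriv V (C.Φ z)).comp (C.tangentMapAt z)) z := by
  have h1 := (Spacetime.contMDiffAt_coordVec (r := 1) (hV (C.Φ z))).mdifferentiableAt one_ne_zero
  exact (HasMFDerivAt.comp z h1.hasMFDerivAt
    (C.mdifferentiable.mdifferentiableAt hz).hasMFDerivAt).hasFDerivAt

theorem coordVec_h (x₀ : M) (p : H) :
    Spacetime.coordVec x₀ (mfderiv (𝓡 (n + 1)) (𝓡 (n + 2)) S.ι p (F.h p))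
      = F.α p • Spacetime.coordVec x₀ (S.l p) + F.β p • Spacetime.coordVec x₀ (S.k p) := by
  rw [F.h_eq]
  simp only [Spacetime.coordVec, map_add, map_smul]
  rfl

theorem contMDiff_mfderiv_h : ContMDiff (𝓡 (n + 1)) (𝓡 (n + 2)).tangent 1
    (fun p ↦ (⟨S.ι p, mfderiv (𝓡 (n + 1)) (𝓡 (n + 2)) S.ι p (F.h p)⟩ :
      TangentBundle (𝓡 (n + 2)) M)) :=
  (S.ι_contMDiff.contMDiff_tangentMap (m := 1) (by norm_num)).comp F.h_contMDiff

theorem differentiableAt_metric_apply {z : EuclideanSpace ℝ (Fin n) × ℝ} (hz : z ∈ C.Φ.source)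
    {V W : ∀ p : H, TangentSpace (𝓡 (n + 2)) (S.ι p)}
    (hV : ContMDiff (𝓡 (n + 1)) (𝓡 (n + 2)).tangent 1
      (fun p ↦ (⟨S.ι p, V p⟩ : TangentBundle (𝓡 (n + 2)) M)))
    (hW : ContMDiff (𝓡 (n + 1)) (𝓡 (n + 2)).tangent 1
      (fun p ↦ (⟨S.ι p, W p⟩ : TangentBundle (𝓡 (n + 2)) M))) :
    DifferentiableAt ℝ (fun y ↦ G.g (S.ι (C.Φ y)) (V (C.Φ y)) (W (C.Φ y))) z := by
  have hγ := (G.differentiableAt_coordMetricCLM (S.ι (C.Φ z))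
    (mem_extChartAt_target (I := 𝓡 (n + 2)) (S.ι (C.Φ z)))).hasFDerivAt
  have hf := C.hasFDerivAt_chartMap hz (mem_extChartAt_source (I := 𝓡 (n + 2)) (S.ι (C.Φ z)))
  have h := ((HasFDerivAt.comp z (g := G.coordMetricCLM (S.ι (C.Φ z))) hγ hf).clm_apply
    (C.hasFDerivAt_coordVec hz hV)).clm_apply (C.hasFDerivAt_coordVec hz hW)
  refine h.differentiableAt.congr_of_eventuallyEq ?_
  filter_upwards [C.eventually_mem_source hz] with y hy
  exact (G.coordMetric_coordVec _ hy.2 _ _).symm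

/-- The coefficient `α` is differentiable in the coordinates, although only `h`, `k` and `l` are
assumed regular: `α = -g (k, h)`. -/
theorem differentiableAt_α {z : EuclideanSpace ℝ (Fin n) × ℝ} (hz : z ∈ C.Φ.source) :
    DifferentiableAt ℝ (fun y ↦ F.α (C.Φ y)) z := by
  have h := (C.differentiableAt_metric_apply hz S.k_contMDiff (contMDiff_mfderiv_h (F := F))).neg
  refine h.congr_of_eventuallyEq (Filter.Eventually.of_forall fun y ↦ ?_)
  simp only [Pi.neg_apply, F.h_eq, map_add, map_smul, S.k_l, S.k_null, smul_eq_mul]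
  ring

theorem differentiableAt_β {z : EuclideanSpace ℝ (Fin n) × ℝ} (hz : z ∈ C.Φ.source) :
    DifferentiableAt ℝ (fun y ↦ F.β (C.Φ y)) z := by
  have h := (C.differentiableAt_metric_apply hz S.l_contMDiff (contMDiff_mfderiv_h (F := F))).neg
  refine h.congr_of_eventuallyEq (Filter.Eventually.of_forall fun y ↦ ?_)
  simp only [Pi.neg_apply, F.h_eq, map_add, map_smul, S.k_l, S.l_null, smul_eq_mul,
    G.g_symm _ (S.l _) (S.k _)]
  ring

/-- `∂_τ q_{ij} = 2 α B^l_{(ij)} + 2 β B^k_{(ij)}`, with the null extrinsic curvatures `B^l` and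
`B^k`. -/
theorem hasDerivAt_inducedMetric {x : EuclideanSpace ℝ (Fin n)} {t : ℝ}
    (hz : (x, t) ∈ C.Φ.source) (i j : Fin n) :
    HasDerivAt (fun s ↦ S.inducedMetric (C.Φ (x, s)) (C.coordField (x, s) i)
        (C.coordField (x, s) j))
      (F.α (C.Φ (x, t)) * (S.nullExtrinsicCurvature S.l (C.Φ (x, t)) (C.coordField (x, t) i)
            (C.coordField (x, t) j)
          + S.nullExtrinsicCurvature S.l (C.Φ (x, t)) (C.coordField (x, t) j)
            (C.coordField (x, t) i))
        + F.β (C.Φ (x, t)) * (S.nullExtrinsicCurvature S.k (C.Φ (x, t)) (C.coordField (x, t) i)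
            (C.coordField (x, t) j)
          + S.nullExtrinsicCurvature S.k (C.Φ (x, t)) (C.coordField (x, t) j)
            (C.coordField (x, t) i))) t := by
  set P := S.ι (C.Φ (x, t))
  have hPs := mem_extChartAt_source (I := 𝓡 (n + 2)) P
  have hPt := mem_extChartAt_target (I := 𝓡 (n + 2)) P
  have hfd : ∀ y, y ∈ C.Φ.source → S.ι (C.Φ y) ∈ (extChartAt (𝓡 (n + 2)) P).source →
      ∀ v, fderiv ℝ (C.chartMap P) y v = S.tangentCoord P (C.Φ y) (C.tangentMapAt y v) :=
    fun y hy hy' v ↦ by rw [(C.hasFDerivAt_chartMap hy hy').fderiv]; rfl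
  have horth : ∀ {V : ∀ p : H, TangentSpace (𝓡 (n + 2)) (S.ι p)},
      (∀ (p : H) (u : TangentSpace (𝓡 (n + 1)) p), mfderiv (𝓡 (n + 1)) 𝓘(ℝ, ℝ) S.τ p u = 0 →
        G.g (S.ι p) (V p) (mfderiv (𝓡 (n + 1)) (𝓡 (n + 2)) S.ι p u) = 0) →
      ∀ v : EuclideanSpace ℝ (Fin n), G.coordMetricCLM P (C.chartMap P (x, t))
        (Spacetime.coordVec P (V (C.Φ (x, t)))) (fderiv ℝ (C.chartMap P) (x, t) (v, 0)) = 0 := by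
    intro V hV v
    rw [hfd _ hz hPs]
    exact (G.coordMetric_coordVec P hPs _ _).trans (hV _ _ (C.mfderiv_τ_tangentMapAt hz (v, 0)))
  have hγ' : ∀ e v w, fderiv ℝ (G.coordMetricCLM P) (extChartAt (𝓡 (n + 2)) P P) e v w
      = fderiv ℝ (G.coordMetricCLM P) (extChartAt (𝓡 (n + 2)) P P) e w v := by
    intro e v w
    rw [← G.fderiv_coordMetric _ hPt, ← G.fderiv_coordMetric _ hPt]
    simp only [G.coordMetric_comm P _ v w]
  have hmain := hasDerivAt_pullback_metric (f := C.chartMap P)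
    (L := fun y ↦ Spacetime.coordVec P (S.l (C.Φ y)))
    (K := fun y ↦ Spacetime.coordVec P (S.k (C.Φ y)))
    (a := fun y ↦ F.α (C.Φ y)) (b := fun y ↦ F.β (C.Φ y)) (x := x) (t := t)
    (γ := G.coordMetricCLM P) (γ' := fderiv ℝ (G.coordMetricCLM P) (extChartAt (𝓡 (n + 2)) P P))
    (u := EuclideanSpace.single i 1) (w := EuclideanSpace.single j 1)
    ((C.eventually_mem_source hz).mono fun y hy ↦
      (C.hasFDerivAt_chartMap hy.1 hy.2).differentiableAt)
    ((C.eventually_mem_source hz).mono fun y hy ↦ by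
      rw [hfd y hy.1 hy.2, ← coordVec_h]
      exact congrArg (S.tangentCoord P (C.Φ y)) (C.flow_eq y hy.1))
    (by simpa only [coordVec_h] using C.contDiffAt_coordVec hz (contMDiff_mfderiv_h (F := F)))
    (C.hasFDerivAt_coordVec hz S.l_contMDiff).differentiableAt
    (C.hasFDerivAt_coordVec hz S.k_contMDiff).differentiableAt
    (C.differentiableAt_α hz) (C.differentiableAt_β hz)
    (G.differentiableAt_coordMetricCLM P hPt).hasFDerivAt
    (fun v w ↦ G.coordMetric_comm _ _ _ _) hγ'
    (horth S.l_orthogonal _) (horth S.l_orthogonal _)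
    (horth S.k_orthogonal _) (horth S.k_orthogonal _)
  have hcurv : ∀ {V : ∀ p : H, TangentSpace (𝓡 (n + 2)) (S.ι p)},
      ContMDiff (𝓡 (n + 1)) (𝓡 (n + 2)).tangent 1
        (fun p ↦ (⟨S.ι p, V p⟩ : TangentBundle (𝓡 (n + 2)) M)) → ∀ i j : Fin n,
      covariantPairing (G.coordMetricCLM P (C.chartMap P (x, t)))
        (fderiv ℝ (G.coordMetricCLM P) (extChartAt (𝓡 (n + 2)) P P))
        (fderiv ℝ (fun y ↦ Spacetime.coordVec P (V (C.Φ y))) (x, t) (EuclideanSpace.single i 1, 0))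
        (Spacetime.coordVec P (V (C.Φ (x, t))))
        (fderiv ℝ (C.chartMap P) (x, t) (EuclideanSpace.single i 1, 0))
        (fderiv ℝ (C.chartMap P) (x, t) (EuclideanSpace.single j 1, 0))
      = S.nullExtrinsicCurvature V (C.Φ (x, t)) (C.coordField (x, t) i)
          (C.coordField (x, t) j) := by
    intro V hV i j
    rw [hfd _ hz hPs, hfd _ hz hPs, (C.hasFDerivAt_coordVec hz hV).fderiv]
    exact (S.nullExtrinsicCurvature_eq V _ _ _).symm
  rw [hcurv S.l_contMDiff, hcurv S.l_contMDiff, hcurv S.k_contMDiff, hcurv S.k_contMDiff] at hmain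
  refine hmain.congr_of_eventuallyEq ?_
  have hline : Filter.Tendsto (fun s : ℝ ↦ (x, s)) (nhds t) (nhds (x, t)) :=
    (Continuous.prodMk_right x).tendsto t
  filter_upwards [hline.eventually (C.eventually_mem_source hz)] with s hs
  rw [hfd _ hs.1 hs.2, hfd _ hs.1 hs.2]
  exact S.inducedMetric_eq P hs.2 _ _

/-- `d(δA)/dτ = δA (α θ_l + β θ_k)`. -/
theorem hasDerivAt_areaElement {x : EuclideanSpace ℝ (Fin n)} {t : ℝ}
    (hz : (x, t) ∈ C.Φ.source) :
    HasDerivAt (fun s ↦ C.areaElement (x, s)) (C.areaElement (x, t) *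
      (F.α (C.Φ (x, t)) * S.expansion S.l (C.Φ (x, t))
        + F.β (C.Φ (x, t)) * S.expansion S.k (C.Φ (x, t)))) t := by
  have h := hasDerivAt_sqrt_det (A := fun s ↦ Matrix.of fun i j ↦
    S.inducedMetric (C.Φ (x, s)) (C.coordField (x, s) i) (C.coordField (x, s) j))
    (fun i j ↦ C.hasDerivAt_inducedMetric hz i j) (C.posDef_metric hz).det_pos
  refine h.congr_deriv (congrArg (C.areaElement (x, t) * ·) ?_)
  rw [C.expansion_eq_sum_coordField hz, C.expansion_eq_sum_coordField hz]
  set q : Matrix (Fin n) (Fin n) ℝ := Matrix.of fun i j ↦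
    S.inducedMetric (C.Φ (x, t)) (C.coordField (x, t) i) (C.coordField (x, t) j)
  have hq : ∀ i j, q⁻¹ j i = q⁻¹ i j := fun i j ↦ (C.posDef_metric hz).isHermitian.inv.apply i j
  have hswap : ∀ B : Fin n → Fin n → ℝ,
      ∑ i, ∑ j, q⁻¹ i j * B j i = ∑ i, ∑ j, q⁻¹ i j * B i j := by
    intro B
    rw [Finset.sum_comm]
    exact Finset.sum_congr rfl fun i _ ↦ Finset.sum_congr rfl fun j _ ↦ by rw [hq]
  generalize hl : (fun i j ↦ S.nullExtrinsicCurvature S.l (C.Φ (x, t)) (C.coordField (x, t) i)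
    (C.coordField (x, t) j)) = Bl
  generalize hk : (fun i j ↦ S.nullExtrinsicCurvature S.k (C.Φ (x, t)) (C.coordField (x, t) i)
    (C.coordField (x, t) j)) = Bk
  simp only [funext_iff] at hl hk
  simp only [hl, hk]
  have hsum : ∑ i, ∑ j, q⁻¹ i j * (F.α (C.Φ (x, t)) * (Bl j i + Bl i j)
        + F.β (C.Φ (x, t)) * (Bk j i + Bk i j))
      = F.α (C.Φ (x, t)) * (∑ i, ∑ j, q⁻¹ i j * Bl j i + ∑ i, ∑ j, q⁻¹ i j * Bl i j)
        + F.β (C.Φ (x, t)) * (∑ i, ∑ j, q⁻¹ i j * Bk j i + ∑ i, ∑ j, q⁻¹ i j * Bk i j) := by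
    simp only [Finset.mul_sum, ← Finset.sum_add_distrib]
    exact Finset.sum_congr rfl fun i _ ↦ Finset.sum_congr rfl fun j _ ↦ by ring
  rw [hsum, hswap Bl, hswap Bk]
  ring

theorem areaRate_eq {x : EuclideanSpace ℝ (Fin n)} {t : ℝ} (hz : (x, t) ∈ C.Φ.source) :
    C.areaRate x t = F.α (C.Φ (x, t)) * S.expansion S.l (C.Φ (x, t))
      + F.β (C.Φ (x, t)) * S.expansion S.k (C.Φ (x, t)) := by
  rw [areaRate, (C.hasDerivAt_areaElement hz).deriv, one_div,
    inv_mul_cancel_left₀ (C.areaElement_pos hz).ne']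

end FoliatedHypersurface.ComovingCoordinates

theorem lemma2 {n : ℕ} {M : Type*} [TopologicalSpace M]
    [ChartedSpace (EuclideanSpace ℝ (Fin (n + 2))) M] [IsManifold (𝓡 (n + 2)) ∞ M]
    (G : Spacetime n M) {H : Type*} [TopologicalSpace H]
    [ChartedSpace (EuclideanSpace ℝ (Fin (n + 1))) H] [IsManifold (𝓡 (n + 1)) 2 H]
    (S : FoliatedHypersurface G H) (F : S.Flow)
    (C : FoliatedHypersurface.ComovingCoordinates F)
    (x : EuclideanSpace ℝ (Fin n)) (t : ℝ) (hxt : (x, t) ∈ C.Φ.source) :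
    (S.IsFutureScreen →
      0 < C.areaElement (x, t) ∧
      DifferentiableAt ℝ (fun s ↦ C.areaElement (x, s)) t ∧
      C.areaRate x t = F.α (C.Φ (x, t)) * S.expansion S.l (C.Φ (x, t)) ∧
      (0 < C.areaRate x t ↔ F.α (C.Φ (x, t)) < 0)) ∧
    (S.IsPastScreen →
      0 < C.areaElement (x, t) ∧
      DifferentiableAt ℝ (fun s ↦ C.areaElement (x, s)) t ∧
      C.areaRate x t = F.α (C.Φ (x, t)) * S.expansion S.l (C.Φ (x, t)) ∧
      (0 < C.areaRate x t ↔ 0 < F.α (C.Φ (x, t)))) := by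
  have hrate := C.areaRate_eq hxt
  refine ⟨fun hS ↦ ⟨C.areaElement_pos hxt, (C.hasDerivAt_areaElement hxt).differentiableAt, ?_⟩,
    fun hS ↦ ⟨C.areaElement_pos hxt, (C.hasDerivAt_areaElement hxt).differentiableAt, ?_⟩⟩
  · obtain ⟨hk, hl⟩ := hS (C.Φ (x, t))
    rw [hk, mul_zero, add_zero] at hrate
    exact ⟨hrate, by
      rw [hrate]
      exact ⟨fun h ↦ (neg_iff_neg_of_mul_pos h).2 hl, fun h ↦ mul_pos_of_neg_of_neg h hl⟩⟩
  · obtain ⟨hk, hl⟩ := hS (C.Φ (x, t))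
    rw [hk, mul_zero, add_zero] at hrate
    exact ⟨hrate, by rw [hrate, mul_pos_iff_of_pos_right hl]⟩
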